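/- Let $p_1 < p_2 < p_3 < \cdots$ denote the increasing sequence of all prime numbers. Assume Cramér's conjecture in the form $p_{n+1} - p_n = O(\log^2 p_n)$ as $n \to \infty$, where $\log$ is the natural logarithm. Then there exist a constant $k > 0$ and an infinite set $E$ of primes such that for every prime $p_n \in E$ $$\frac{\log p_n}{\sqrt{p_n}} < \sqrt{p_{n+1}} - \sqrt{p_n} < \frac{k \log^2 p_n}{\sqrt{p_n}}.$$ -/

import Mathlib

/-- The increasing enumeration `2, 3, 5, 7, …` of the primes, indexed from `0`. -/
noncomputable def nthPrime (n : ℕ) : ℕ := Nat.nth Nat.Prime n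

/-- Cramér's conjecture: `p_{n+1} - p_n = O((log p_n)^2)` as `n → ∞`, the difference being taken
in the real numbers. -/
def CramerConjecture : Prop :=
  (fun n : ℕ => (nthPrime (n + 1) : ℝ) - (nthPrime n : ℝ))
    =O[Filter.atTop] (fun n : ℕ => Real.log (nthPrime n) ^ 2)

/-! With g = p_{n+1} - p_n, the difference of roots is g / (√p_n + √p_{n+1}), and Bertrand's
postulate bounds the denominator by 3√p_n. Cramér's bound on g gives the upper inequality, and g > 3
log p_n gives the lower one. Such gaps occur infinitely often by Westzynthius's argument, proved
unconditionally. Sieving [1, Kt] by the class 0 modulo primes in [Z, t] leaves O(K² t / log t)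
integers; greedy classes modulo primes below Z cut this to t / log t, since ∏ (1 - 1/p) tends to 0;
each survivor gets its own prime in (t, 4t]. The Chinese remainder theorem turns this covering into
Kt consecutive composites. -/

/-- The partial products `∏_{p < Z} (1 - 1/p)` over primes become arbitrarily small. -/
theorem exists_prod_one_sub_inv_prime_le {ε : ℝ} (hε : 0 < ε) :
    ∃ Z : ℕ, ∏ p ∈ Z.primesBelow, (1 - 1 / (p : ℝ)) ≤ ε := by
  have hdiv := (not_summable_iff_tendsto_nat_atTop_of_nonneg (fun n => Set.indicator_nonneg
    (fun m _ => by positivity) n)).1 not_summable_one_div_on_primes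
  obtain ⟨Z, hZ⟩ := (hdiv.eventually_ge_atTop (-Real.log ε)).exists
  refine ⟨Z, ?_⟩
  have hsum : ∑ i ∈ Finset.range Z, Set.indicator {p | p.Prime} (fun n : ℕ => (1 : ℝ) / n) i
      = ∑ p ∈ Z.primesBelow, 1 / (p : ℝ) := by
    rw [Nat.primesBelow_eq_filter_range, Finset.sum_filter]
    refine Finset.sum_congr rfl fun i _ => ?_
    simp [Set.indicator_apply]
  rw [hsum] at hZ
  calc ∏ p ∈ Z.primesBelow, (1 - 1 / (p : ℝ))
      ≤ ∏ p ∈ Z.primesBelow, Real.exp (-(1 / (p : ℝ))) := by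
        refine Finset.prod_le_prod (fun p hp => ?_) fun p _ => ?_
        · have h1 : (1 : ℝ) ≤ p := by exact_mod_cast (Nat.one_lt_of_mem_primesBelow hp).le
          rw [sub_nonneg, div_le_one (by positivity)]
          exact h1
        · linarith [Real.add_one_le_exp (-(1 / (p : ℝ)))]
    _ = Real.exp (-∑ p ∈ Z.primesBelow, 1 / (p : ℝ)) := by
        rw [← Real.exp_sum, Finset.sum_neg_distrib]
    _ ≤ Real.exp (Real.log ε) := Real.exp_le_exp.2 (by linarith)
    _ = ε := Real.exp_log hε

/-- Some residue class modulo `p` contains at least a proportion `1/p` of a finite set. -/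
theorem exists_card_filter_mod_ne_le (S : Finset ℕ) {p : ℕ} (hp : 0 < p) :
    ∃ r : ℕ, ((S.filter fun n => n % p ≠ r).card : ℝ) ≤ (1 - 1 / (p : ℝ)) * S.card := by
  have hp' : (0 : ℝ) < p := by exact_mod_cast hp
  obtain ⟨r, -, hr⟩ := Finset.exists_le_card_fiber_of_nsmul_le_card_of_maps_to
    (s := S) (t := Finset.range p) (f := fun n => n % p) (b := (S.card : ℝ) / p)
    (fun n _ => Finset.mem_range.2 (Nat.mod_lt n hp)) ⟨0, Finset.mem_range.2 hp⟩
    (by rw [Finset.card_range, nsmul_eq_mul]; field_simp; exact le_rfl)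
  refine ⟨r, ?_⟩
  have h := Finset.card_filter_add_card_filter_not (s := S) (fun n => n % p = r)
  have h' : ((S.filter fun n => n % p = r).card : ℝ) + (S.filter fun n => n % p ≠ r).card
      = S.card := by exact_mod_cast h
  have : (1 - 1 / (p : ℝ)) * S.card = S.card - S.card / p := by ring
  linarith

/-- Greedy sieving: one residue class per modulus can be removed so that at most the proportion
`∏ (1 - 1/p)` of a finite set remains. -/
theorem exists_residues_card_filter_le (S Q : Finset ℕ) (hQ : ∀ p ∈ Q, 0 < p) :
    ∃ c : ℕ → ℕ, ((S.filter fun n => ∀ p ∈ Q, n % p ≠ c p).card : ℝ)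
      ≤ (∏ p ∈ Q, (1 - 1 / (p : ℝ))) * S.card := by
  induction Q using Finset.induction_on with
  | empty => exact ⟨fun _ => 0, by simp⟩
  | insert q Q hq ih =>
    obtain ⟨c, hc⟩ := ih fun p hp => hQ p (Finset.mem_insert_of_mem hp)
    have hq0 : 0 < q := hQ q (Finset.mem_insert_self q Q)
    obtain ⟨r, hr⟩ := exists_card_filter_mod_ne_le (S.filter fun n => ∀ p ∈ Q, n % p ≠ c p) hq0
    refine ⟨Function.update c q r, ?_⟩
    have hset : (S.filter fun n => ∀ p ∈ insert q Q, n % p ≠ Function.update c q r p)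
        = (S.filter fun n => ∀ p ∈ Q, n % p ≠ c p).filter fun n => n % q ≠ r := by
      ext n
      simp only [Finset.mem_filter, Finset.forall_mem_insert, Function.update_self, and_assoc]
      refine and_congr_right fun _ => ?_
      rw [and_comm]
      refine and_congr_left fun _ => forall₂_congr fun p hp => ?_
      rw [Function.update_of_ne (ne_of_mem_of_not_mem hp hq)]
    rw [hset, Finset.prod_insert hq, mul_assoc]
    refine hr.trans (mul_le_mul_of_nonneg_left hc ?_)
    have h1 : (1 : ℝ) ≤ q := by exact_mod_cast hq0
    rw [sub_nonneg, div_le_one (by positivity)]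
    exact h1

/-- A set with no more elements than there are moduli can be covered by one class per modulus. -/
theorem exists_residues_cover (S B : Finset ℕ) (h : S.card ≤ B.card) :
    ∃ c : ℕ → ℕ, ∀ n ∈ S, ∃ p ∈ B, n % p = c p % p := by
  obtain ⟨f⟩ : Nonempty (S ↪ B) := Function.Embedding.nonempty_of_card_le (by simpa using h)
  rcases S.eq_empty_or_nonempty with rfl | ⟨s, hs⟩
  · exact ⟨fun _ => 0, by simp⟩
  have : Nonempty S := ⟨⟨s, hs⟩⟩
  have hinj : Function.Injective fun n : S => (f n : ℕ) :=
    Subtype.val_injective.comp f.injective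
  refine ⟨fun p => (Function.invFun (fun n : S => (f n : ℕ)) p : S), fun n hn =>
    ⟨f ⟨n, hn⟩, (f ⟨n, hn⟩).2, ?_⟩⟩
  have := Function.leftInverse_invFun hinj ⟨n, hn⟩
  exact congrArg (fun m : S => (n % (f ⟨n, hn⟩ : ℕ) = (m : ℕ) % (f ⟨n, hn⟩ : ℕ))) this |>.mpr rfl

/-- An integer up to `K * t` with no prime factor in `[Z, t]` is `Z`-smooth or a small multiple of
a prime; this bounds the number of such integers. -/
theorem card_filter_not_dvd_medium_le (K Z t : ℕ) :
    ((Finset.Icc 1 (K * t)).filter fun n => ∀ p ∈ Nat.primesLE t, Z ≤ p → ¬ p ∣ n).card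
      ≤ 2 ^ Z.primesBelow.card * Nat.sqrt (K * t) + K * Nat.primeCounting (K * t) := by
  have hsub : ((Finset.Icc 1 (K * t)).filter fun n => ∀ p ∈ Nat.primesLE t, Z ≤ p → ¬ p ∣ n)
      ⊆ Nat.smoothNumbersUpTo (K * t) Z ∪
        (Finset.range K ×ˢ Nat.primesLE (K * t)).image fun x => x.1 * x.2 := by
    intro n hn
    simp only [Finset.mem_filter, Finset.mem_Icc] at hn
    obtain ⟨⟨h1, h2⟩, h3⟩ := hn
    rw [Finset.mem_union]
    by_cases hs : n ∈ Nat.smoothNumbers Z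
    · exact Or.inl (Nat.mem_smoothNumbersUpTo.2 ⟨h2, hs⟩)
    · right
      rw [Nat.mem_smoothNumbers'] at hs
      push Not at hs
      obtain ⟨p, hp, ⟨m, rfl⟩, hpZ⟩ := hs
      have hpt : t < p := by
        by_contra hle
        exact h3 p (Nat.mem_primesLE.2 ⟨not_lt.1 hle, hp⟩) hpZ (dvd_mul_right p m)
      have hm : 0 < m := Nat.pos_of_ne_zero fun h => by simp [h] at h1
      refine Finset.mem_image.2 ⟨(m, p), Finset.mem_product.2 ⟨Finset.mem_range.2 ?_,
        Nat.mem_primesLE.2 ⟨(Nat.le_mul_of_pos_right p hm).trans h2, hp⟩⟩, mul_comm m p⟩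
      by_contra hle
      have : K * t < p * m := by
        calc K * t ≤ m * t := Nat.mul_le_mul_right t (not_lt.1 hle)
          _ < m * p := Nat.mul_lt_mul_of_pos_left hpt hm
          _ = p * m := mul_comm m p
      omega
  refine (Finset.card_le_card hsub).trans ((Finset.card_union_le _ _).trans (add_le_add
    (Nat.smoothNumbersUpTo_card_le _ _) (Finset.card_image_le.trans ?_)))
  rw [Finset.card_product, Finset.card_range, Nat.primesLE_card_eq_primeCounting]

/-- Chebyshev's bounds give π(4t) ≥ 2.5 t / log t and π(t) ≤ 1.5 t / log t, so (t, 4t] holds enough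
primes for the last covering step. -/
theorem eventually_div_log_le_primeCounting_sub :
    ∀ᶠ t : ℕ in Filter.atTop, (t : ℝ) / Real.log t
      ≤ (Nat.primeCounting (4 * t) : ℝ) - Nat.primeCounting t := by
  have hup := tendsto_natCast_atTop_atTop (R := ℝ) |>.eventually
    (Chebyshev.eventually_primeCounting_le (ε := 0.01) (by norm_num))
  have hlog := tendsto_natCast_atTop_atTop (R := ℝ) |>.eventually
    (Real.isLittleO_log_id_atTop.bound (show (0 : ℝ) < 0.01 by norm_num))
  have hlarge := (Real.tendsto_log_atTop.comp (tendsto_natCast_atTop_atTop (R := ℝ))).eventually_ge_atTop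
    (100 : ℝ)
  filter_upwards [hup, hlog, hlarge, Filter.eventually_ge_atTop 1] with t h1 h2 h3 h4
  have ht : (1 : ℝ) ≤ t := by exact_mod_cast h4
  simp only [Function.comp, Nat.floor_natCast, id, Real.norm_eq_abs] at h1 h2 h3
  have hL : (0 : ℝ) < Real.log t := by linarith
  rw [abs_of_pos hL, abs_of_pos (by linarith)] at h2
  have hl2 := Real.log_two_gt_d9
  have hl2' := Real.log_two_lt_d9
  have hl4 : Real.log 4 = 2 * Real.log 2 := by
    rw [show (4 : ℝ) = 2 ^ 2 by norm_num, Real.log_pow]; norm_num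
  have hlow := Chebyshev.pi_ge (4 * t)
  push_cast at hlow
  have e1 : Real.log (4 * t) = Real.log 4 + Real.log t := Real.log_mul (by norm_num) (by linarith)
  have e2 : Real.log (4 * t + 1) ≤ Real.log 8 + Real.log t := by
    rw [← Real.log_mul (by norm_num) (by linarith)]
    exact Real.log_le_log (by linarith) (by linarith)
  have hl8 : Real.log 8 = 3 * Real.log 2 := by
    rw [show (8 : ℝ) = 2 ^ 3 by norm_num, Real.log_pow]; norm_num
  have h5 : (2.5 : ℝ) * (t / Real.log t) ≤ (4 * t * Real.log 2 - Real.log (4 * t + 1)) /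
      Real.log (4 * t) := by
    rw [e1, le_div_iff₀ (by linarith), mul_div_assoc', div_mul_eq_mul_div, div_le_iff₀ hL]
    have a1 : 2.5 * (t : ℝ) * (Real.log 4 + Real.log t) ≤ 2.5 * t * (1.02 * Real.log t) := by
      gcongr; linarith
    have a2 : 2.55 * (t : ℝ) ≤ 4 * t * Real.log 2 - Real.log (4 * t + 1) := by nlinarith
    nlinarith
  have h6 : (Real.log 4 + 0.01) * t / Real.log t ≤ 1.5 * (t / Real.log t) := by
    rw [mul_div_assoc]
    gcongr
    linarith
  linarith

/-- The smooth numbers contribute only O(√t), so Chebyshev's upper bound for π(Kt) dominates. -/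
theorem eventually_sqrt_add_primeCounting_le (A K : ℕ) (hK : 0 < K) :
    ∀ᶠ t : ℕ in Filter.atTop, ((A * Nat.sqrt (K * t) + K * Nat.primeCounting (K * t) : ℕ) : ℝ)
      ≤ 3 * K ^ 2 * (t / Real.log t) := by
  have hK1 : (1 : ℝ) ≤ K := by exact_mod_cast hK
  have hKt : Filter.Tendsto (fun t : ℕ => (((K * t : ℕ)) : ℝ)) Filter.atTop Filter.atTop :=
    tendsto_natCast_atTop_atTop.comp (Filter.tendsto_id.const_mul_atTop' hK)
  have hup := hKt.eventually
    (Chebyshev.eventually_primeCounting_le (ε := 0.01) (by norm_num))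
  have hlog := tendsto_natCast_atTop_atTop (R := ℝ) |>.eventually
    ((isLittleO_log_rpow_atTop (r := 1 / 2) (by norm_num)).bound
      (show (0 : ℝ) < 1 / (A + 1) by positivity))
  filter_upwards [hup, hlog, Filter.eventually_ge_atTop 2] with t h1 h2 h3
  have ht : (2 : ℝ) ≤ t := by exact_mod_cast h3
  have hL : (0 : ℝ) < Real.log t := Real.log_pos (by linarith)
  rw [Nat.floor_natCast] at h1
  push_cast at h1
  rw [← Real.sqrt_eq_rpow, Real.norm_eq_abs, Real.norm_eq_abs, abs_of_pos hL,
    abs_of_nonneg (Real.sqrt_nonneg _)] at h2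
  have hs : Real.sqrt t * Real.sqrt t = t := Real.mul_self_sqrt (by linarith)
  have hs0 : 0 < Real.sqrt t := Real.sqrt_pos.2 (by linarith)
  have hl2' := Real.log_two_lt_d9
  have hl4 : Real.log 4 = 2 * Real.log 2 := by
    rw [show (4 : ℝ) = 2 ^ 2 by norm_num, Real.log_pow]; norm_num
  have hX : 0 ≤ (t : ℝ) / Real.log t := by positivity
  have p1 : (Nat.primeCounting (K * t) : ℝ) ≤ 1.5 * K * (t / Real.log t) := by
    refine h1.trans ?_
    have : (Real.log 4 + 0.01) * (K * t) / Real.log (K * t) ≤ 1.5 * (K * t) / Real.log t := by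
      gcongr
      · linarith
      · nlinarith
    refine this.trans (le_of_eq (by ring))
  have p2 : (A : ℝ) * Real.sqrt t ≤ t / Real.log t := by
    rw [le_div_iff₀ hL]
    have : (A : ℝ) * Real.log t ≤ Real.sqrt t := by
      calc (A : ℝ) * Real.log t ≤ (A + 1) * Real.log t := by gcongr; linarith
        _ ≤ (A + 1) * (1 / (A + 1) * Real.sqrt t) := by gcongr
        _ = Real.sqrt t := by field_simp
    nlinarith
  have p3 : (Nat.sqrt (K * t) : ℝ) ≤ K * Real.sqrt t := by
    refine Real.nat_sqrt_le_real_sqrt.trans ?_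
    push_cast
    rw [Real.sqrt_mul (by linarith)]
    gcongr
    rw [Real.sqrt_le_left (by linarith)]
    nlinarith
  push_cast
  calc (A : ℝ) * Nat.sqrt (K * t) + K * Nat.primeCounting (K * t)
      ≤ A * (K * Real.sqrt t) + K * (1.5 * K * (t / Real.log t)) := by gcongr
    _ = K * (A * Real.sqrt t) + 1.5 * K ^ 2 * (t / Real.log t) := by ring
    _ ≤ K * (t / Real.log t) + 1.5 * K ^ 2 * (t / Real.log t) := by gcongr
    _ ≤ K ^ 2 * (t / Real.log t) + 1.5 * K ^ 2 * (t / Real.log t) := by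
        gcongr; nlinarith
    _ ≤ 3 * K ^ 2 * (t / Real.log t) := by nlinarith [mul_nonneg (sq_nonneg (K : ℝ)) hX]

/-- For every `K` and all large `t`, one residue class for each prime up to `4 * t` can be chosen so
that together they cover the interval `[1, K * t]`. -/
theorem eventually_exists_residues_cover (K : ℕ) (hK : 0 < K) :
    ∀ᶠ t : ℕ in Filter.atTop, ∃ c : ℕ → ℕ, ∀ n, 1 ≤ n → n ≤ K * t →
      ∃ p, p.Prime ∧ p ≤ 4 * t ∧ n % p = c p % p := by
  have hK0 : (0 : ℝ) < K := by exact_mod_cast hK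
  -- This ε cancels the factor 3K² in the count of integers left by the medium primes.
  obtain ⟨Z, hZ⟩ := exists_prod_one_sub_inv_prime_le (ε := 1 / (3 * (K : ℝ) ^ 2)) (by positivity)
  filter_upwards [eventually_div_log_le_primeCounting_sub,
    eventually_sqrt_add_primeCounting_le (2 ^ Z.primesBelow.card) K hK,
    Filter.eventually_ge_atTop Z] with t h1 h2 h3
  set S := (Finset.Icc 1 (K * t)).filter fun n => ∀ p ∈ Nat.primesLE t, Z ≤ p → ¬ p ∣ n with hS
  obtain ⟨c₁, hc₁⟩ := exists_residues_card_filter_le S Z.primesBelow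
    fun p hp => (Nat.prime_of_mem_primesBelow hp).pos
  set B := Nat.primesLE (4 * t) \ Nat.primesLE t with hB
  have hcard : (S.filter fun n => ∀ p ∈ Z.primesBelow, n % p ≠ c₁ p).card ≤ B.card := by
    have hBc : (B.card : ℝ) = (Nat.primeCounting (4 * t) : ℝ) - Nat.primeCounting t := by
      rw [hB, Finset.card_sdiff_of_subset (Nat.primesLE_mono (by omega)),
        Nat.cast_sub (Finset.card_le_card (Nat.primesLE_mono (by omega))),
        Nat.primesLE_card_eq_primeCounting, Nat.primesLE_card_eq_primeCounting]
    have hSc : (S.card : ℝ) ≤ 3 * K ^ 2 * (t / Real.log t) :=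
      le_trans (by exact_mod_cast card_filter_not_dvd_medium_le K Z t) h2
    rw [← Nat.cast_le (α := ℝ), hBc]
    refine hc₁.trans (le_trans ?_ h1)
    calc _ ≤ 1 / (3 * (K : ℝ) ^ 2) * (3 * K ^ 2 * (t / Real.log t)) :=
          mul_le_mul hZ hSc (by positivity) (by positivity)
      _ = t / Real.log t := by field_simp
  obtain ⟨c₂, hc₂⟩ := exists_residues_cover _ B hcard
  refine ⟨fun p => if p < Z then c₁ p else if p ≤ t then 0 else c₂ p, fun n hn1 hn2 => ?_⟩
  by_cases hnS : n ∈ S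
  · by_cases hn : ∀ p ∈ Z.primesBelow, n % p ≠ c₁ p
    · obtain ⟨p, hp, hnp⟩ := hc₂ n (Finset.mem_filter.2 ⟨hnS, hn⟩)
      rw [hB, Finset.mem_sdiff, Nat.mem_primesLE, Nat.mem_primesLE] at hp
      obtain ⟨⟨hp4, hpp⟩, hpt⟩ := hp
      have hpt' : ¬ p ≤ t := fun h => hpt ⟨h, hpp⟩
      exact ⟨p, hpp, hp4, by beta_reduce; rw [if_neg (by omega), if_neg hpt', hnp]⟩
    · push Not at hn
      obtain ⟨p, hp, hnp⟩ := hn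
      have hpZ := Nat.lt_of_mem_primesBelow hp
      exact ⟨p, Nat.prime_of_mem_primesBelow hp, by omega,
        by beta_reduce; rw [if_pos hpZ, ← hnp, Nat.mod_mod]⟩
  · rw [hS, Finset.mem_filter, Finset.mem_Icc] at hnS
    push Not at hnS
    obtain ⟨p, hp, hpZ, hpn⟩ := hnS ⟨hn1, hn2⟩
    obtain ⟨hpt, hpp⟩ := Nat.mem_primesLE.1 hp
    exact ⟨p, hpp, by omega, by
      beta_reduce
      rw [if_neg (by omega), if_pos hpt, Nat.zero_mod]; exact Nat.mod_eq_zero_of_dvd hpn⟩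

/-! ### From coverings to long prime gaps -/

theorem eventually_exists_composite_interval (K : ℕ) (hK : 0 < K) :
    ∀ᶠ t : ℕ in Filter.atTop, ∃ a : ℕ, 2 ≤ a ∧ a ≤ 2 * 4 ^ (4 * t) ∧
      ∀ n, 1 ≤ n → n ≤ K * t → ¬ (a + n).Prime := by
  filter_upwards [eventually_exists_residues_cover K hK, Filter.eventually_ge_atTop 1] with t ht ht1
  obtain ⟨c, hc⟩ := ht
  have hs : ∀ p ∈ Nat.primesLE (4 * t), id p ≠ 0 := fun p hp => (Nat.prime_of_mem_primesLE hp).ne_zero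
  have pp : Set.Pairwise (Nat.primesLE (4 * t) : Set ℕ) (Function.onFun Nat.Coprime id) :=
    fun p hp q hq hpq => (Nat.coprime_primes (Nat.prime_of_mem_primesLE hp)
      (Nat.prime_of_mem_primesLE hq)).2 hpq
  -- The shift is ≡ -c p modulo each p, so a covered n becomes a multiple of p.
  have hlt := Nat.chineseRemainderOfFinset_lt_prod (fun p => p - c p % p) id hs pp
  obtain ⟨⟨k, hk⟩, hk₀⟩ : ∃ k, k = Nat.chineseRemainderOfFinset (fun p => p - c p % p) id _ hs pp := ⟨_, rfl⟩
  rw [← hk₀] at hlt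
  have hP := primorial_le_four_pow (4 * t)
  have hdvd : ∀ p, p.Prime → p ≤ 4 * t → p ∣ primorial (4 * t) := fun p hp hpt => by
    rw [primorial_eq_prod_primesLE]
    exact Finset.dvd_prod_of_mem _ (Nat.mem_primesLE.2 ⟨hpt, hp⟩)
  have hlt' : k < primorial (4 * t) := by rw [primorial_eq_prod_primesLE]; simpa using hlt
  -- Adding the primorial keeps the residues and makes a + n exceed p, so divisibility by p rules
  -- out primality.
  refine ⟨primorial (4 * t) + k, ?_, by omega, fun n hn1 hn2 hprime => ?_⟩
  · have := Nat.le_of_dvd (primorial_pos _) (hdvd 2 Nat.prime_two (by omega))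
    omega
  · obtain ⟨p, hp, hpt, hnp⟩ := hc n hn1 hn2
    have hkp := hk p (Nat.mem_primesLE.2 ⟨hpt, hp⟩)
    simp only [id] at hkp
    have hkn : p ∣ k + n := by
      have h1 : k + n ≡ (p - c p % p) + c p % p [MOD p] :=
        hkp.add (by rw [Nat.ModEq, hnp, Nat.mod_mod])
      rw [Nat.sub_add_cancel (Nat.mod_lt _ hp.pos).le] at h1
      exact (Nat.modEq_zero_iff_dvd).1 (h1.trans (by simp [Nat.ModEq]))
    have hd : p ∣ primorial (4 * t) + k + n := by
      rw [add_assoc]; exact dvd_add (hdvd p hp hpt) hkn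
    have hle := Nat.le_of_dvd (primorial_pos _) (hdvd p hp hpt)
    rcases (Nat.dvd_prime hprime).1 hd with h | h
    · exact hp.one_lt.ne' h
    · omega

theorem nthPrime_prime (n : ℕ) : (nthPrime n).Prime := Nat.prime_nth_prime n

theorem nthPrime_strictMono : StrictMono nthPrime := Nat.nth_strictMono Nat.infinite_setOfPred_prime

theorem exists_nthPrime_le_lt {a : ℕ} (ha : 2 ≤ a) :
    ∃ n, nthPrime n ≤ a ∧ a < nthPrime (n + 1) := by
  have h0 : nthPrime 0 ≤ a := by rw [nthPrime, Nat.nth_prime_zero_eq_two]; exact ha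
  have hex : ∃ m, a < nthPrime m := ⟨a + 1, lt_of_lt_of_le (by omega) nthPrime_strictMono.le_apply⟩
  obtain ⟨m, hm, hmin⟩ := Nat.findX hex
  cases m with
  | zero => omega
  | succ n => exact ⟨n, not_lt.1 (hmin n (Nat.lt_succ_self n)), hm⟩

theorem nthPrime_succ_le_two_mul (n : ℕ) : nthPrime (n + 1) ≤ 2 * nthPrime n := by
  obtain ⟨q, hq, hlt, hle⟩ := Nat.exists_prime_lt_and_le_two_mul _ (nthPrime_prime n).ne_zero
  have hqn : nthPrime (Nat.count Nat.Prime q) = q := Nat.nth_count hq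
  rw [← hqn] at hlt hle
  exact (nthPrime_strictMono.monotone (nthPrime_strictMono.lt_iff_lt.1 hlt)).trans hle

/-- A form of Westzynthius's theorem: long gaps between primes of size at most `2 * 4 ^ (4 * t)`. -/
theorem eventually_exists_long_gap (K : ℕ) (hK : 0 < K) :
    ∀ᶠ t : ℕ in Filter.atTop, ∃ n, nthPrime n ≤ 2 * 4 ^ (4 * t) ∧
      nthPrime n + K * t < nthPrime (n + 1) := by
  filter_upwards [eventually_exists_composite_interval K hK] with t ⟨a, ha2, ha, hcomp⟩
  obtain ⟨n, hn, hn'⟩ := exists_nthPrime_le_lt ha2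
  refine ⟨n, hn.trans ha, ?_⟩
  by_contra hle
  have := hcomp (nthPrime (n + 1) - a) (by omega) (by omega)
  rw [Nat.add_sub_cancel' hn'.le] at this
  exact this (nthPrime_prime _)

theorem infinite_setOf_three_mul_log_lt_gap :
    {n : ℕ | 3 * Real.log (nthPrime n) < (nthPrime (n + 1) : ℝ) - nthPrime n}.Infinite := by
  intro hfin
  obtain ⟨M, hM⟩ := (hfin.image fun n => nthPrime (n + 1)).bddAbove
  -- K = 20 suffices: 3 log p_n ≤ 3(8t + 1) log 2 < 20t. Taking t > M forces p_{n+1} > M,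
  -- contradicting the bound.
  obtain ⟨t, ⟨n, hle, hgap⟩, ht⟩ := ((eventually_exists_long_gap 20 (by norm_num)).and
    (Filter.eventually_ge_atTop (M + 1))).exists
  have hgap' : (nthPrime n : ℝ) + 20 * t < nthPrime (n + 1) := by exact_mod_cast hgap
  have hp0 : (0 : ℝ) < nthPrime n := by exact_mod_cast (nthPrime_prime n).pos
  have ht1 : (1 : ℝ) ≤ t := by exact_mod_cast (show 1 ≤ t by omega)
  have hlog : Real.log (nthPrime n) ≤ Real.log 2 + 4 * t * (2 * Real.log 2) := by
    have h : (nthPrime n : ℝ) ≤ 2 * 4 ^ (4 * t) := by exact_mod_cast hle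
    refine (Real.log_le_log hp0 h).trans (le_of_eq ?_)
    rw [Real.log_mul (by norm_num) (by positivity), Real.log_pow,
      show (4 : ℝ) = 2 ^ 2 by norm_num, Real.log_pow]
    push_cast
    ring
  have hl2 := Real.log_two_lt_d9
  have hmem : n ∈ {n : ℕ | 3 * Real.log (nthPrime n) < (nthPrime (n + 1) : ℝ) - nthPrime n} := by
    simp only [Set.mem_ofPred_eq]
    nlinarith
  have := hM (Set.mem_image_of_mem _ hmem)
  omega

theorem mainTheorem11 (hCramer : CramerConjecture) :
    ∃ (k : ℝ) (E : Set ℕ), 0 < k ∧ E.Infinite ∧ (∀ p ∈ E, Nat.Prime p) ∧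
      ∀ n : ℕ, nthPrime n ∈ E →
        Real.log (nthPrime n) / Real.sqrt (nthPrime n)
            < Real.sqrt (nthPrime (n + 1)) - Real.sqrt (nthPrime n) ∧
        Real.sqrt (nthPrime (n + 1)) - Real.sqrt (nthPrime n)
            < k * Real.log (nthPrime n) ^ 2 / Real.sqrt (nthPrime n) := by
  obtain ⟨C, hC0, hC⟩ := hCramer.exists_pos
  obtain ⟨N, hN⟩ := Filter.eventually_atTop.1 hC.bound
  -- Indices below N are dropped because Cramér's bound with constant C is only known from N on.
  refine ⟨C, nthPrime '' ({n : ℕ | 3 * Real.log (nthPrime n) <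
    (nthPrime (n + 1) : ℝ) - nthPrime n} \ Set.Iio N), hC0,
    (infinite_setOf_three_mul_log_lt_gap.sdiff (Set.finite_Iio N)).image
      nthPrime_strictMono.injective.injOn, ?_, fun n hn => ?_⟩
  · rintro p ⟨n, -, rfl⟩
    exact nthPrime_prime n
  · obtain ⟨m, ⟨hgap, hmN⟩, hmn⟩ := hn
    obtain rfl := nthPrime_strictMono.injective hmn
    simp only [Set.mem_ofPred_eq, Set.mem_Iio, not_lt] at hgap hmN
    have hcr := hN m hmN
    have hp2 : (2 : ℝ) ≤ nthPrime m := by exact_mod_cast (nthPrime_prime m).two_le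
    have hlog : 0 < Real.log (nthPrime m) := Real.log_pos (by linarith)
    have hbert : (nthPrime (m + 1) : ℝ) ≤ 2 * nthPrime m := by
      exact_mod_cast nthPrime_succ_le_two_mul m
    have hs0 : 0 < Real.sqrt (nthPrime m) := Real.sqrt_pos.2 (by linarith)
    have hs : Real.sqrt (nthPrime m) ^ 2 = nthPrime m := Real.sq_sqrt (by linarith)
    have hs' : Real.sqrt (nthPrime (m + 1)) ^ 2 = nthPrime (m + 1) := Real.sq_sqrt (by positivity)
    rw [Real.norm_eq_abs, Real.norm_eq_abs, abs_of_pos (by linarith), abs_of_nonneg (sq_nonneg _)]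
      at hcr
    set s := Real.sqrt (nthPrime m)
    set s' := Real.sqrt (nthPrime (m + 1))
    set L := Real.log (nthPrime m)
    have hs'0 : 0 ≤ s' := Real.sqrt_nonneg _
    rw [← hs, ← hs'] at hgap hcr
    rw [← hs, ← hs'] at hbert
    have hlt : s < s' := by nlinarith
    have hle : s' ≤ 2 * s := by nlinarith
    constructor
    · rw [div_lt_iff₀ hs0]
      nlinarith
    · rw [lt_div_iff₀ hs0]
      nlinarith
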